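/- Let $p,n\ge 0$ be integers. Consider probability distributions $P$ of $(X,Y(1),Y(0),T)$ on $\mathbb R^p\times\mathbb R\times\mathbb R\times\{0,1\}$; put $Y=T\,Y(1)+(1-T)\,Y(0)$ and $\Delta=Y(1)-Y(0)$ (the individual treatment effect, ITE). Let $\mathcal E$ be the class of all such $P$ for which the law of at least one coordinate of $X$ is absolutely continuous with respect to Lebesgue measure on $\mathbb R$, and $Y(1)$ and $Y(0)$ are each continuous random variables. Here "continuous" may be read throughout either as "having a continuous distribution function" or as "having a density with respect to Lebesgue measure"; the theorem is asserted under each of the two readings. Let $$\mathcal P_{\mathrm{SI}}=\{P\in\mathcal E:\ (Y(1),Y(0))\perp T\mid X\}$$ be the class of strongly ignorable distributions in $\mathcal E$. Given $P$, let $(X_i,Y_i(1),Y_i(0),T_i)$, $i=1,\dots,n$, and $(X,Y(1),Y(0),T)$ (a new unit) be i.i.d. from $P$. A (possibly randomized) prediction set $\widehat C(x)\subseteq\mathbb R$, $x\in\mathbb R^p$, is constructed from the observed data $\mathcal O_n=\{(X_i,Y_i,T_i)\}_{i=1}^n$ and possibly an auxiliary random seed $S$, with values in some measurable space and a fixed law,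 independent of all units; the indicator $\mathbf 1\{y\in\widehat C(x)\}$ is assumed to be jointly measurable in $(S,\mathcal O_n,x,y)$. Probabilities $\mathbb P_P$ and expectations $\mathbb E_P$ are over the seed, the $n$ units and the new unit. **Theorem (finite-sample impossibility over $\mathcal P_{\mathrm{SI}}$).** Let $\alpha\in(0,1)$ and suppose that $$\sup_{P\in\mathcal P_{\mathrm{SI}}}\mathbb P_P\bigl(\Delta\notin\widehat C(X)\bigr)\le\alpha .$$ Then for every $P\in\mathcal P_{\mathrm{SI}}$ and every $y\in\mathbb R$, $$\mathbb P_P\bigl(y\notin\widehat C(X)\bigr)\le\alpha ,$$ and, for every $P\in\mathcal P_{\mathrm{SI}}$, $$\mathbb E_P\bigl[\mathrm{length}(\widehat C(X))\bigr]=\infty ,$$ where $\mathrm{length}$ denotes Lebesgue measure. -/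

import Mathlib

open MeasureTheory ProbabilityTheory

noncomputable section

namespace ITE

/-- Full data `(X, Y(1), Y(0), T)` of one unit: covariates in `ℝᵖ`, the two potential outcomes,
and the binary treatment (`true` for `T = 1`, `false` for `T = 0`). -/
abbrev FullData (p : ℕ) : Type := (Fin p → ℝ) × ℝ × ℝ × Bool

/-- Observed data `(X, Y, T)` of one unit. -/
abbrev ObsData (p : ℕ) : Type := (Fin p → ℝ) × ℝ × Bool

variable {p : ℕ}

/-- The covariates `X`. -/
def covariates (o : FullData p) : Fin p → ℝ := o.1

/-- The potential outcome `Y(1)`. -/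
def outcome1 (o : FullData p) : ℝ := o.2.1

/-- The potential outcome `Y(0)`. -/
def outcome0 (o : FullData p) : ℝ := o.2.2.1

/-- The treatment indicator `T`. -/
def treatment (o : FullData p) : Bool := o.2.2.2

/-- The observed outcome `Y = T Y(1) + (1 - T) Y(0)`. -/
def observedOutcome (o : FullData p) : ℝ :=
  if treatment o = true then outcome1 o else outcome0 o

/-- The individual treatment effect `Δ = Y(1) - Y(0)`. -/
def effect (o : FullData p) : ℝ := outcome1 o - outcome0 o

/-- The observed part `(X, Y, T)` of the full data. -/
def observe (o : FullData p) : ObsData p := (covariates o, observedOutcome o, treatment o)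

theorem measurable_covariates : Measurable (covariates (p := p)) := measurable_fst

/-- The two usual meanings of "a real random variable is continuous". -/
inductive ContinuityNotion where
  /-- The distribution function is continuous, i.e. the law has no atoms. -/
  | continuousCDF : ContinuityNotion
  /-- The law has a density with respect to Lebesgue measure. -/
  | hasDensity : ContinuityNotion

/-- The law `ν` on the real line is continuous, in the given sense. -/
def ContinuityNotion.Holds : ContinuityNotion → Measure ℝ → Prop
  | .continuousCDF, ν => ∀ x : ℝ, ν {x} = 0
  | .hasDensity, ν => ν ≪ volume

/-- The class `ℰ` of all probability distributions of `(X, Y(1), Y(0), T)` such that at least one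
coordinate of `X` is absolutely continuous with respect to one-dimensional Lebesgue measure, and
each of `Y(1)` and `Y(0)` is continuous (a condition on the two marginal laws). -/
def classE (p : ℕ) (c : ContinuityNotion) : Set (ProbabilityMeasure (FullData p)) :=
  {P | (∃ j : Fin p, (P : Measure (FullData p)).map (fun o => covariates o j) ≪ volume) ∧
    c.Holds ((P : Measure (FullData p)).map outcome1) ∧
    c.Holds ((P : Measure (FullData p)).map outcome0)}

/-- The class of distributions in `ℰ` with `(Y(1), Y(0)) ⊥ T | X` (strong ignorability). -/
def classSI (p : ℕ) (c : ContinuityNotion) : Set (ProbabilityMeasure (FullData p)) :=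
  {P | P ∈ classE p c ∧
    CondIndepFun (MeasurableSpace.comap covariates inferInstance) measurable_covariates.comap_le
      (fun o : FullData p => (outcome1 o, outcome0 o)) treatment (P : Measure (FullData p))}

/-- A (possibly randomized) prediction set built from `n` observed units: the set at covariate
value `x` is `C s d x`, where `d` is the observed data and `s` is the value of an auxiliary random
seed. Membership is jointly measurable. A non-randomized set is the case of a one-point `S`. -/
structure PredictionSet (p n : ℕ) (S : Type*) [MeasurableSpace S] where
  /-- The prediction set. -/
  C : S → (Fin n → ObsData p) → (Fin p → ℝ) → Set ℝ
  /-- The law of the seed, which is independent of the data. -/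
  seedLaw : ProbabilityMeasure S
  measurableSet_mem :
    MeasurableSet {q : S × (Fin n → ObsData p) × (Fin p → ℝ) × ℝ |
      q.2.2.2 ∈ C q.1 q.2.1 q.2.2.1}

namespace PredictionSet

variable {n : ℕ} {S : Type*} [MeasurableSpace S]

/-- The outcomes of the whole experiment: the seed, the full data of the `n` sampled units, and
the full data of the new unit. -/
abbrev Experiment (p n : ℕ) (S : Type*) : Type _ := S × (Fin n → FullData p) × FullData p

/-- The law of the experiment when the `n` units and the new unit are i.i.d. from `P` and the seed
is independent of them. -/
def law (K : PredictionSet p n S) (P : ProbabilityMeasure (FullData p)) :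
    Measure (Experiment p n S) :=
  (K.seedLaw : Measure S).prod
    ((Measure.pi fun _ : Fin n => (P : Measure (FullData p))).prod (P : Measure (FullData p)))

/-- The prediction set `Ĉ(X)` at the covariates of the new unit. -/
def predicted (K : PredictionSet p n S) (ω : Experiment p n S) : Set ℝ :=
  K.C ω.1 (fun i => observe (ω.2.1 i)) (covariates ω.2.2)

/-- The probability `ℙ_P(Δ ∉ Ĉ(X))` of missing the effect of the new unit. -/
def missEffect (K : PredictionSet p n S) (P : ProbabilityMeasure (FullData p)) : ENNReal :=
  K.law P {ω | effect ω.2.2 ∉ K.predicted ω}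

/-- The worst-case miscoverage `sup_{P ∈ 𝒫_SI} ℙ_P(Δ ∉ Ĉ(X))`. -/
def supMissEffect (K : PredictionSet p n S) (c : ContinuityNotion) : ENNReal :=
  ⨆ P ∈ classSI p c, K.missEffect P

/-- The probability `ℙ_P(y ∉ Ĉ(X))` of missing the fixed real number `y`. -/
def missPoint (K : PredictionSet p n S) (P : ProbabilityMeasure (FullData p)) (y : ℝ) : ENNReal :=
  K.law P {ω | y ∉ K.predicted ω}

/-- The expected Lebesgue measure `𝔼_P[length(Ĉ(X))]`. -/
def expectedLength (K : PredictionSet p n S) (P : ProbabilityMeasure (FullData p)) : ENNReal :=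
  ∫⁻ ω, volume (K.predicted ω) ∂(K.law P)

end PredictionSet

end ITE

end

/-! Only one potential outcome of a unit is ever observed, so the other one can be altered without
any effect on the observed data. If the treatment is a function `σ` of the covariates, strong
ignorability holds whatever the outcomes are; altering the unobserved outcome so that `Δ = y` then
gives a strongly ignorable law with the same observed data, under which missing `y` is missing the
effect. Hence `y` is missed with probability at most `α` whenever the treatment is deterministic.

For a general strongly ignorable `P` the treatment is `τ (X, u)` with `u` uniform and independent
of the outcomes. Cut the line into cells of length `1 / M` and draw one `u` per cell rather than one
per unit, reading off the cell from the absolutely continuous coordinate of `X`. Given the drawn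
values the treatment is a function of `X`, while averaging over them reproduces the law of the
observed data except when two units share a cell, which has probability tending to `0` as `M → ∞`.
By Tonelli's theorem the expected length is the integral over `y` of the coverage probabilities, all
of which are at least `1 - α`. -/

open Filter Function Topology

namespace ITE

section RandomVariables

variable {Ω 𝓧 β γ E : Type*} [MeasurableSpace Ω] [MeasurableSpace 𝓧] [MeasurableSpace β]
  [MeasurableSpace γ] [MeasurableSpace E] {μ : Measure Ω}

theorem map_absolutelyContinuous_map_add_map {f g₁ g₂ : Ω → E} (hf : Measurable f)
    (hg₁ : Measurable g₁) (hg₂ : Measurable g₂) (h : ∀ ω, f ω = g₁ ω ∨ f ω = g₂ ω) :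
    μ.map f ≪ μ.map g₁ + μ.map g₂ := by
  refine Measure.AbsolutelyContinuous.mk fun N hN hN0 => ?_
  rw [Measure.add_apply, add_eq_zero, Measure.map_apply hg₁ hN, Measure.map_apply hg₂ hN] at hN0
  rw [Measure.map_apply hf hN]
  refine measure_mono_null (fun ω (hω : f ω ∈ N) => ?_) (measure_union_null hN0.1 hN0.2)
  rcases h ω with h₁ | h₂
  · exact .inl (show g₁ ω ∈ N from h₁ ▸ hω)
  · exact .inr (show g₂ ω ∈ N from h₂ ▸ hω)

variable [StandardBorelSpace Ω] [StandardBorelSpace β] [Nonempty β] [StandardBorelSpace γ]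
  [Nonempty γ] [IsFiniteMeasure μ] {X : Ω → 𝓧} {Z : Ω → β} {T : Ω → γ}

theorem condIndepFun_of_ae_eq_comp (hX : Measurable X) (hZ : Measurable Z) (hT : Measurable T)
    {σ : 𝓧 → γ} (hσ : Measurable σ) (h : T =ᵐ[μ] σ ∘ X) :
    CondIndepFun (MeasurableSpace.comap X inferInstance) hX.comap_le Z T μ := by
  rw [condIndepFun_iff_condDistrib_prod_ae_eq_prodMkRight hT hZ hX, condDistrib_congr_left h,
    condDistrib_congr_left h,
    ← condIndepFun_iff_condDistrib_prod_ae_eq_prodMkRight (hσ.comp hX) hZ hX]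
  exact condIndepFun_of_measurable_right hZ (hσ.comp (comap_measurable X))

theorem exists_map_prod_unitInterval_eq_of_condIndepFun (hX : Measurable X) (hZ : Measurable Z)
    (hT : Measurable T)
    (h : CondIndepFun (MeasurableSpace.comap X inferInstance) hX.comap_le Z T μ) :
    ∃ τ : 𝓧 → unitInterval → γ, Measurable (uncurry τ) ∧
      (μ.prod volume).map (fun q => ((X q.1, Z q.1), τ (X q.1) q.2)) =
        μ.map (fun ω => ((X ω, Z ω), T ω)) := by
  obtain ⟨τ, hτ, hτT⟩ := Kernel.exists_measurable_map_eq_unitInterval (condDistrib T X μ)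
  refine ⟨τ, hτ, ?_⟩
  have hXZ : Measurable fun ω => (X ω, Z ω) := hX.prodMk hZ
  have hred : Measurable fun q : Ω × unitInterval => ((X q.1, Z q.1), τ (X q.1) q.2) :=
    (hXZ.comp measurable_fst).prodMk (hτ.comp ((hX.comp measurable_fst).prodMk measurable_snd))
  have hcond := (condIndepFun_iff_condDistrib_prod_ae_eq_prodMkRight hT hZ hX).1 h
  rw [← compProd_map_condDistrib hT.aemeasurable, Measure.compProd_congr hcond]
  ext A hA
  rw [Measure.compProd_apply hA, lintegral_map (Kernel.measurable_kernel_prodMk_left hA) hXZ,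
    Measure.map_apply hred hA, Measure.prod_apply (hred hA)]
  refine lintegral_congr fun ω => ?_
  rw [Kernel.prodMkRight_apply, ← hτT, Measure.map_apply hτ.of_uncurry_left
    (measurable_prodMk_left hA)]
  rfl

end RandomVariables

section DistinctCells

variable {ι Ω : Type*} [MeasurableSpace Ω]

theorem ae_injective_pi [Fintype ι] {E : Type*} [MeasurableSpace E] [MeasurableEq E] (ν : Measure Ω)
    [IsProbabilityMeasure ν] {f : Ω → E} (hf : Measurable f) [NullSingletonClass (ν.map f)] :
    ∀ᵐ w ∂(Measure.pi fun _ : ι => ν), Injective fun i => f (w i) := by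
  have := Measure.isProbabilityMeasure_map (μ := ν) hf.aemeasurable
  have hdiag : ∀ᵐ q ∂((ν.map f).prod (ν.map f)), q.1 ≠ q.2 := by
    refine (Measure.ae_prod_iff_ae_ae measurableSet_diagonal.compl).2 (ae_of_all _ fun x => ?_)
    exact (measure_eq_zero_iff_ae_notMem.1 (measure_singleton x)).mono fun z hz h => hz h.symm
  have hne : ∀ i k : ι, i ≠ k →
      ∀ᵐ w ∂(Measure.pi fun _ : ι => ν), f (w i) ≠ f (w k) := fun i k hik => by
    have hpair : (Measure.pi fun _ : ι => ν).map (fun w => (f (w i), f (w k))) =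
        (ν.map f).prod (ν.map f) := by
      rw [Measure.map_prod_map _ _ hf hf,
        ← Measure.infinitePi_map_eval_prod (P := fun _ : ι => ν) hik, Measure.infinitePi_eq_pi,
        Measure.map_map (by fun_prop) (by fun_prop)]
      rfl
    exact ae_of_ae_map (f := fun w : ι → Ω => (f (w i), f (w k))) (by fun_prop) (hpair ▸ hdiag)
  filter_upwards [ae_all_iff.2 fun i => ae_all_iff.2 fun k => eventually_imp_distrib_left.2
    (hne i k)] with w hw i k hik
  exact not_imp_not.1 (hw i k) hik

theorem eventually_injective_floor_mul [Finite ι] {x : ι → ℝ} (hx : Injective x) :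
    ∀ᶠ M : ℕ in atTop, Injective fun i => ⌊(M : ℝ) * x i⌋ := by
  have hne : ∀ i k : ι, i ≠ k → ∀ᶠ M : ℕ in atTop, ⌊(M : ℝ) * x i⌋ ≠ ⌊(M : ℝ) * x k⌋ := by
    intro i k hik
    have hpos : 0 < |x i - x k| := abs_pos.2 (sub_ne_zero.2 (hx.ne hik))
    filter_upwards [(tendsto_natCast_atTop_atTop.atTop_mul_const hpos).eventually_ge_atTop 1]
      with M hM hfloor
    have hlt := Int.abs_sub_lt_one_of_floor_eq_floor hfloor
    rw [← mul_sub, abs_mul, Nat.abs_cast] at hlt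
    exact hM.not_gt hlt
  filter_upwards [eventually_all.2 fun i => eventually_all.2 fun k => eventually_imp_distrib_left.2
    (hne i k)] with M hM i k hik
  exact not_imp_not.1 (hM i k) hik

theorem measurableSet_not_injective_comp [Finite ι] {κ : Type*} [MeasurableSpace κ]
    [Countable κ] [MeasurableSingletonClass κ] {b : Ω → κ} (hb : Measurable b) :
    MeasurableSet {w : ι → Ω | ¬ Injective fun i => b (w i)} := by
  have h : Measurable fun (w : ι → Ω) (i : ι) => b (w i) := by fun_prop
  exact h (MeasurableSet.of_discrete (s := {k : ι → κ | ¬ Injective k}))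

theorem tendsto_pi_not_injective_floor_mul [Fintype ι] (ν : Measure Ω) [IsProbabilityMeasure ν]
    {f : Ω → ℝ} (hf : Measurable f) [NullSingletonClass (ν.map f)] :
    Tendsto (fun M : ℕ => (Measure.pi fun _ : ι => ν)
      {w | ¬ Injective fun i => ⌊(M : ℝ) * f (w i)⌋}) atTop (𝓝 0) := by
  rw [← measure_empty (μ := Measure.pi fun _ : ι => ν)]
  refine tendsto_measure_of_ae_tendsto_indicator_of_isFiniteMeasure atTop MeasurableSet.empty
    (fun M => measurableSet_not_injective_comp (b := fun w => ⌊(M : ℝ) * f w⌋) (by fun_prop)) ?_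
  filter_upwards [ae_injective_pi ν hf] with w hw
  filter_upwards [eventually_injective_floor_mul hw] with M hM
  simpa only [Set.mem_empty_iff_false, iff_false, Set.mem_ofPred_eq, not_not] using hM

end DistinctCells

section SharedDraws

variable {ι Ω V O κ : Type*} [Fintype ι] [MeasurableSpace Ω] [MeasurableSpace V]
  [MeasurableSpace O]

theorem lintegral_pi_map (ν : Measure Ω) [IsProbabilityMeasure ν] {g : Ω → O} (hg : Measurable g)
    {F : (ι → O) → ENNReal} (hF : Measurable F) :
    ∫⁻ d, F d ∂(Measure.pi fun _ : ι => ν.map g) =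
      ∫⁻ w, F (fun i => g (w i)) ∂(Measure.pi fun _ : ι => ν) := by
  have := Measure.isProbabilityMeasure_map (μ := ν) hg.aemeasurable
  rw [← Measure.pi_map_pi fun _ => hg.aemeasurable, lintegral_map hF (by fun_prop)]

theorem lintegral_pi_prod (ν : Measure Ω) [SigmaFinite ν] (θ : Measure V) [SigmaFinite θ]
    {F : (ι → Ω × V) → ENNReal} (hF : Measurable F) :
    ∫⁻ z, F z ∂(Measure.pi fun _ : ι => ν.prod θ) =
      ∫⁻ w, ∫⁻ v, F (fun i => (w i, v i)) ∂(Measure.pi fun _ : ι => θ)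
        ∂(Measure.pi fun _ : ι => ν) := by
  have hpair : Measurable fun q : (ι → Ω) × (ι → V) => F fun i => (q.1 i, q.2 i) := by fun_prop
  rw [← lintegral_prod _ hpair.aemeasurable,
    ← (measurePreserving_arrowProdEquivProdArrow Ω V ι (fun _ => ν) (fun _ => θ)).lintegral_comp
      hpair]
  rfl

theorem lintegral_infinitePi_comp_of_injective (θ : Measure V) [IsProbabilityMeasure θ]
    {k : ι → κ} (hk : Injective k) {H : (ι → V) → ENNReal} (hH : Measurable H) :
    ∫⁻ U, H (fun i => U (k i)) ∂(Measure.infinitePi fun _ : κ => θ) =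
      ∫⁻ v, H v ∂(Measure.pi fun _ : ι => θ) := by
  rw [← Measure.infinitePi_eq_pi,
    ← Measure.map_infinitePi_infinitePi_of_inj (P := fun _ : κ => θ) hk,
    lintegral_map hH (by fun_prop)]

variable [MeasurableSpace κ] [Countable κ] [MeasurableSingletonClass κ]

theorem measurable_eval_comp {b : Ω → κ} (hb : Measurable b) :
    Measurable fun q : Ω × (κ → V) => q.2 (b q.1) := by
  have heval : Measurable fun q : κ × (κ → V) => q.2 q.1 :=
    measurable_from_prod_countable_right fun k => measurable_pi_apply k
  exact heval.comp ((hb.comp measurable_fst).prodMk measurable_snd)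

theorem lintegral_pi_prod_le_lintegral_infinitePi_add (ν : Measure Ω) [IsProbabilityMeasure ν]
    (θ : Measure V) [IsProbabilityMeasure θ] {b : Ω → κ} (hb : Measurable b)
    {F : (ι → Ω × V) → ENNReal} (hF : Measurable F) (hF1 : ∀ z, F z ≤ 1) :
    ∫⁻ z, F z ∂(Measure.pi fun _ : ι => ν.prod θ) ≤
      (∫⁻ U, ∫⁻ w, F (fun i => (w i, U (b (w i)))) ∂(Measure.pi fun _ : ι => ν)
        ∂(Measure.infinitePi fun _ : κ => θ)) +
      (Measure.pi fun _ : ι => ν) {w | ¬ Injective fun i => b (w i)} := by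
  set D : Set (ι → Ω) := {w | ¬ Injective fun i => b (w i)}
  have hD : MeasurableSet D := measurableSet_not_injective_comp hb
  have hshared : Measurable fun q : (ι → Ω) × (κ → V) =>
      F fun i => (q.1 i, q.2 (b (q.1 i))) := by
    refine hF.comp (measurable_pi_lambda _ fun i => ?_)
    have hi : Measurable fun q : (ι → Ω) × (κ → V) => q.1 i := by fun_prop
    exact hi.prodMk ((measurable_eval_comp hb).comp (hi.prodMk measurable_snd))
  have hpoint : ∀ w : ι → Ω, ∫⁻ v, F (fun i => (w i, v i)) ∂(Measure.pi fun _ : ι => θ) ≤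
      (∫⁻ U, F (fun i => (w i, U (b (w i)))) ∂(Measure.infinitePi fun _ : κ => θ)) +
        D.indicator 1 w := fun w => by
    by_cases hw : w ∈ D
    · rw [Set.indicator_of_mem hw]
      refine le_add_left ((lintegral_mono fun v => hF1 _).trans_eq ?_)
      rw [lintegral_one, measure_univ, Pi.one_apply]
    · refine le_add_right (lintegral_infinitePi_comp_of_injective θ (not_not.1 hw)
        (H := fun v => F fun i => (w i, v i)) (by fun_prop)).ge
  calc ∫⁻ z, F z ∂(Measure.pi fun _ : ι => ν.prod θ)
      ≤ ∫⁻ w, ((∫⁻ U, F (fun i => (w i, U (b (w i)))) ∂(Measure.infinitePi fun _ : κ => θ)) +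
          D.indicator 1 w) ∂(Measure.pi fun _ : ι => ν) :=
        (lintegral_pi_prod ν θ hF).trans_le (lintegral_mono hpoint)
    _ = _ := by
        rw [lintegral_add_right _ (measurable_one.indicator hD), lintegral_indicator_one hD,
          lintegral_lintegral_swap hshared.aemeasurable]

end SharedDraws

namespace ContinuityNotion

variable {c : ContinuityNotion} {ν ν' : Measure ℝ}

theorem Holds.of_absolutelyContinuous (h : c.Holds ν') (hν : ν ≪ ν') : c.Holds ν := by
  cases c with
  | continuousCDF => exact fun x => hν (h x)
  | hasDensity => exact hν.trans h

theorem Holds.add (h : c.Holds ν) (h' : c.Holds ν') : c.Holds (ν + ν') := by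
  cases c with
  | continuousCDF => exact fun x => by rw [Measure.add_apply, h x, h' x, add_zero]
  | hasDensity => exact Measure.AbsolutelyContinuous.add_left h h'

theorem Holds.map_add_const (h : c.Holds ν) (a : ℝ) : c.Holds (ν.map (· + a)) := by
  cases c with
  | continuousCDF =>
    intro x
    rw [Measure.map_apply (measurable_add_const a) (measurableSet_singleton x),
      Set.preimage_add_right_singleton]
    exact h _
  | hasDensity =>
    exact (Measure.AbsolutelyContinuous.map h (measurable_add_const a)).trans
      (map_add_right_eq_self volume a).absolutelyContinuous

theorem Holds.map_of_eq_add_or_eq_add {Ω : Type*} [MeasurableSpace Ω] {μ : Measure Ω}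
    {f g₁ g₂ : Ω → ℝ} (hf : Measurable f) (hg₁ : Measurable g₁) (hg₂ : Measurable g₂)
    (h₁ : c.Holds (μ.map g₁)) (h₂ : c.Holds (μ.map g₂)) (a₁ a₂ : ℝ)
    (h : ∀ ω, f ω = g₁ ω + a₁ ∨ f ω = g₂ ω + a₂) : c.Holds (μ.map f) := by
  have hadd := (h₁.map_add_const a₁).add (h₂.map_add_const a₂)
  rw [Measure.map_map (by fun_prop) hg₁, Measure.map_map (by fun_prop) hg₂] at hadd
  exact hadd.of_absolutelyContinuous
    (map_absolutelyContinuous_map_add_map hf (by fun_prop) (by fun_prop) h)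

end ContinuityNotion

section Units

variable {p : ℕ}

/-- The unit `o` with its treatment replaced by `t`, both potential outcomes being kept. -/
def withTreatment (o : FullData p) (t : Bool) : FullData p :=
  (covariates o, outcome1 o, outcome0 o, t)

/-- The unit `o` with its unobserved potential outcome replaced by the value for which the
individual treatment effect is `y`. -/
def withEffect (y : ℝ) (o : FullData p) : FullData p :=
  (covariates o, if treatment o = true then outcome1 o else outcome0 o + y,
    if treatment o = true then outcome1 o - y else outcome0 o, treatment o)

@[fun_prop]
theorem measurable_outcome1 : Measurable (outcome1 (p := p)) := measurable_snd.fst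

@[fun_prop]
theorem measurable_outcome0 : Measurable (outcome0 (p := p)) := measurable_snd.snd.fst

@[fun_prop]
theorem measurable_treatment : Measurable (treatment (p := p)) := measurable_snd.snd.snd

attribute [fun_prop] measurable_covariates

@[fun_prop]
theorem measurable_effect : Measurable (effect (p := p)) :=
  measurable_outcome1.sub measurable_outcome0

theorem measurableSet_treatment_eq_true : MeasurableSet {o : FullData p | treatment o = true} :=
  measurable_treatment (measurableSet_singleton true)

@[fun_prop]
theorem measurable_observe : Measurable (observe (p := p)) :=
  measurable_covariates.prodMk ((Measurable.ite measurableSet_treatment_eq_true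
    measurable_outcome1 measurable_outcome0).prodMk measurable_treatment)

theorem measurable_withTreatment :
    Measurable fun q : FullData p × Bool => withTreatment q.1 q.2 := by
  unfold withTreatment
  fun_prop

@[fun_prop]
theorem measurable_withEffect (y : ℝ) : Measurable (withEffect (p := p) y) :=
  measurable_covariates.prodMk
    ((Measurable.ite measurableSet_treatment_eq_true (by fun_prop) (by fun_prop)).prodMk
      ((Measurable.ite measurableSet_treatment_eq_true (by fun_prop) (by fun_prop)).prodMk
        measurable_treatment))

theorem effect_withEffect (y : ℝ) (o : FullData p) : effect (withEffect y o) = y := by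
  simp only [effect, outcome1, outcome0, withEffect]
  split_ifs <;> ring

theorem observe_withEffect (y : ℝ) (o : FullData p) : observe (withEffect y o) = observe o := by
  have h : observedOutcome (withEffect y o) = observedOutcome o := by
    cases ho : o.2.2.2 <;>
      simp [observedOutcome, outcome1, outcome0, treatment, withEffect, ho]
  exact congrArg (fun r => (covariates o, r, treatment o)) h

theorem outcome1_withEffect (y : ℝ) (o : FullData p) :
    outcome1 (withEffect y o) = outcome1 o + 0 ∨ outcome1 (withEffect y o) = outcome0 o + y := by
  simp only [outcome1, outcome0, withEffect, add_zero]
  exact ite_eq_or_eq _ _ _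

theorem outcome0_withEffect (y : ℝ) (o : FullData p) :
    outcome0 (withEffect y o) = outcome1 o + -y ∨ outcome0 (withEffect y o) = outcome0 o + 0 := by
  simp only [outcome1, outcome0, withEffect, add_zero, ← sub_eq_add_neg]
  exact ite_eq_or_eq _ _ _

end Units

section ClassSI

variable {p : ℕ} {c : ContinuityNotion} {P : ProbabilityMeasure (FullData p)}

theorem map_mem_classE (hP : P ∈ classE p c) {f : FullData p → FullData p} (hf : Measurable f)
    (hcov : ∀ o, covariates (f o) = covariates o) {a₁ a₀ b₁ b₀ : ℝ}
    (hout₁ : ∀ o, outcome1 (f o) = outcome1 o + a₁ ∨ outcome1 (f o) = outcome0 o + a₀)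
    (hout₀ : ∀ o, outcome0 (f o) = outcome1 o + b₁ ∨ outcome0 (f o) = outcome0 o + b₀) :
    P.map hf.aemeasurable ∈ classE p c := by
  obtain ⟨⟨j, hj⟩, h₁, h₀⟩ := hP
  refine ⟨⟨j, ?_⟩, ?_, ?_⟩ <;>
    rw [ProbabilityMeasure.toMeasure_map, Measure.map_map (by fun_prop) hf]
  · simpa only [comp_def, hcov] using hj
  · exact .map_of_eq_add_or_eq_add (by fun_prop) measurable_outcome1 measurable_outcome0 h₁ h₀
      a₁ a₀ hout₁
  · exact .map_of_eq_add_or_eq_add (by fun_prop) measurable_outcome1 measurable_outcome0 h₁ h₀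
      b₁ b₀ hout₀

theorem measurable_withTreatment_comp_covariates {σ : (Fin p → ℝ) → Bool} (hσ : Measurable σ) :
    Measurable fun o : FullData p => withTreatment o (σ (covariates o)) :=
  measurable_withTreatment.comp (measurable_id.prodMk (hσ.comp measurable_covariates))

theorem map_withTreatment_mem_classE (hP : P ∈ classE p c) {σ : (Fin p → ℝ) → Bool}
    (hσ : Measurable σ) :
    P.map (measurable_withTreatment_comp_covariates hσ).aemeasurable ∈ classE p c :=
  map_mem_classE (a₁ := 0) (a₀ := 0) (b₁ := 0) (b₀ := 0) hP
    (measurable_withTreatment_comp_covariates hσ) (fun _ => rfl) (fun _ => .inl (add_zero _).symm)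
    (fun _ => .inr (add_zero _).symm)

theorem map_withEffect_mem_classE (hP : P ∈ classE p c) (y : ℝ) :
    P.map (measurable_withEffect y).aemeasurable ∈ classE p c :=
  map_mem_classE hP (measurable_withEffect y) (fun _ => rfl) (outcome1_withEffect y)
    (outcome0_withEffect y)

theorem mem_classSI_of_treatment_ae_eq (hP : P ∈ classE p c) {σ : (Fin p → ℝ) → Bool}
    (hσ : Measurable σ) (h : treatment =ᵐ[(P : Measure (FullData p))] σ ∘ covariates) :
    P ∈ classSI p c :=
  ⟨hP, condIndepFun_of_ae_eq_comp measurable_covariates (by fun_prop) measurable_treatment hσ h⟩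

theorem exists_map_withTreatment_eq (hP : P ∈ classSI p c) :
    ∃ τ : (Fin p → ℝ) → unitInterval → Bool, Measurable (uncurry τ) ∧
      ((P : Measure (FullData p)).prod volume).map
        (fun q => withTreatment q.1 (τ (covariates q.1) q.2)) = P := by
  obtain ⟨τ, hτ, hmap⟩ := exists_map_prod_unitInterval_eq_of_condIndepFun measurable_covariates
    (measurable_outcome1.prodMk measurable_outcome0) measurable_treatment hP.2
  refine ⟨τ, hτ, ?_⟩
  have hpair : Measurable fun q : FullData p × unitInterval =>
      ((covariates q.1, outcome1 q.1, outcome0 q.1), τ (covariates q.1) q.2) :=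
    Measurable.prodMk (by fun_prop)
      (hτ.comp ((measurable_covariates.comp measurable_fst).prodMk measurable_snd))
  have hunit : Measurable fun z : ((Fin p → ℝ) × ℝ × ℝ) × Bool =>
      ((z.1.1, z.1.2.1, z.1.2.2, z.2) : FullData p) := by fun_prop
  have h := congrArg (Measure.map fun z : ((Fin p → ℝ) × ℝ × ℝ) × Bool =>
    ((z.1.1, z.1.2.1, z.1.2.2, z.2) : FullData p)) hmap
  rw [Measure.map_map hunit hpair, Measure.map_map hunit (by fun_prop)] at h
  exact h.trans Measure.map_id

end ClassSI

namespace PredictionSet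

variable {p n : ℕ} {S : Type*} [MeasurableSpace S] (K : PredictionSet p n S)

section MissingAPoint

/-- The conditional probability that the prediction set misses `y`, given the observed data `d`,
when the covariates of the new unit have law `ν`. -/
noncomputable def missPointGiven (ν : Measure (Fin p → ℝ)) (y : ℝ) (d : Fin n → ObsData p) :
    ENNReal :=
  ((K.seedLaw : Measure S).prod ν) {q | y ∉ K.C q.1 d q.2}

variable {K} in
theorem missPointGiven_le_one {ν : Measure (Fin p → ℝ)} [IsProbabilityMeasure ν] {y : ℝ}
    {d : Fin n → ObsData p} : K.missPointGiven ν y d ≤ 1 :=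
  prob_le_one

theorem measurableSet_notMem_C (y : ℝ) :
    MeasurableSet {q : (Fin n → ObsData p) × S × (Fin p → ℝ) | y ∉ K.C q.2.1 q.1 q.2.2} := by
  have h : Measurable fun q : (Fin n → ObsData p) × S × (Fin p → ℝ) =>
      (q.2.1, q.1, q.2.2, y) := by fun_prop
  exact (h K.measurableSet_mem).compl

theorem measurable_missPointGiven (ν : Measure (Fin p → ℝ)) [SFinite ν] (y : ℝ) :
    Measurable (K.missPointGiven ν y) :=
  measurable_measure_prodMk_left (K.measurableSet_notMem_C y)

theorem missPoint_eq_lintegral_missPointGiven (P : ProbabilityMeasure (FullData p)) (y : ℝ) :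
    K.missPoint P y =
      ∫⁻ d, K.missPointGiven ((P : Measure (FullData p)).map covariates) y (fun i => observe (d i))
        ∂(Measure.pi fun _ : Fin n => (P : Measure (FullData p))) := by
  have hmiss : MeasurableSet {q : S × (Fin n → FullData p) × FullData p |
      y ∉ K.C q.1 (fun i => observe (q.2.1 i)) (covariates q.2.2)} := by
    have h : Measurable fun q : S × (Fin n → FullData p) × FullData p =>
      ((fun i => observe (q.2.1 i)), q.1, covariates q.2.2) := by fun_prop
    exact h (K.measurableSet_notMem_C y)
  have hgiven : ∀ d : Fin n → ObsData p, K.missPointGiven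
      ((P : Measure (FullData p)).map covariates) y d = ∫⁻ s, (P : Measure (FullData p))
        {o | y ∉ K.C s d (covariates o)} ∂(K.seedLaw : Measure S) := fun d => by
    have hd : MeasurableSet {q : S × (Fin p → ℝ) | y ∉ K.C q.1 d q.2} :=
      measurable_prodMk_left (K.measurableSet_notMem_C y)
    rw [missPointGiven, Measure.prod_apply hd]
    exact lintegral_congr fun s => Measure.map_apply measurable_covariates
      (measurable_prodMk_left hd)
  have hjoint : Measurable (uncurry fun (d : Fin n → FullData p) s => (P : Measure (FullData p))
      {o | y ∉ K.C s (fun i => observe (d i)) (covariates o)}) :=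
    (measurable_measure_prodMk_left (measurableSet_preimage MeasurableEquiv.prodAssoc.measurable
      hmiss)).comp measurable_swap
  simp_rw [hgiven]
  rw [lintegral_lintegral_swap hjoint.aemeasurable]
  refine (Measure.prod_apply hmiss).trans (lintegral_congr fun s => ?_)
  exact Measure.prod_apply (measurable_prodMk_left hmiss)

theorem missPoint_eq_lintegral_of_map_eq {W : Type*} [MeasurableSpace W] {ρ : Measure W}
    [IsProbabilityMeasure ρ] {g : W → FullData p} (hg : Measurable g)
    {P : ProbabilityMeasure (FullData p)} (h : ρ.map g = P) (y : ℝ) :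
    K.missPoint P y =
      ∫⁻ w, K.missPointGiven ((P : Measure (FullData p)).map covariates) y
        (fun i => observe (g (w i))) ∂(Measure.pi fun _ : Fin n => ρ) := by
  have hF : Measurable fun d : Fin n → FullData p =>
      K.missPointGiven ((P : Measure (FullData p)).map covariates) y fun i => observe (d i) :=
    (K.measurable_missPointGiven _ y).comp (by fun_prop)
  rw [missPoint_eq_lintegral_missPointGiven, ← lintegral_pi_map ρ hg hF, h]

theorem missPoint_map_eq_lintegral (P : ProbabilityMeasure (FullData p))
    {f : FullData p → FullData p} (hf : Measurable f)
    (hcov : ∀ o, covariates (f o) = covariates o) (y : ℝ) :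
    K.missPoint (P.map hf.aemeasurable) y =
      ∫⁻ d, K.missPointGiven ((P : Measure (FullData p)).map covariates) y
        (fun i => observe (f (d i))) ∂(Measure.pi fun _ : Fin n => (P : Measure (FullData p))) := by
  rw [K.missPoint_eq_lintegral_of_map_eq hf (P.toMeasure_map hf.aemeasurable).symm,
    ProbabilityMeasure.toMeasure_map, Measure.map_map measurable_covariates hf]
  simp only [comp_def, hcov]

theorem missPoint_map_withEffect (P : ProbabilityMeasure (FullData p)) (y : ℝ) :
    K.missPoint (P.map (measurable_withEffect y).aemeasurable) y = K.missPoint P y := by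
  rw [K.missPoint_map_eq_lintegral P (measurable_withEffect y) (fun _ => rfl),
    missPoint_eq_lintegral_missPointGiven]
  simp only [observe_withEffect]

end MissingAPoint

section Coverage

variable {c : ContinuityNotion} {P : ProbabilityMeasure (FullData p)} {y : ℝ}

theorem missPoint_eq_missEffect (h : ∀ᵐ o ∂(P : Measure (FullData p)), effect o = y) :
    K.missPoint P y = K.missEffect P := by
  have hnew : ∀ᵐ ω ∂(K.law P), effect ω.2.2 = y :=
    (Measure.quasiMeasurePreserving_snd.comp Measure.quasiMeasurePreserving_snd).ae h
  refine measure_congr ?_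
  filter_upwards [hnew] with ω hω
  exact congrArg (· ∉ K.predicted ω) hω.symm

theorem missPoint_le_supMissEffect_of_treatment_ae_eq (hP : P ∈ classE p c)
    {σ : (Fin p → ℝ) → Bool} (hσ : Measurable σ)
    (h : treatment =ᵐ[(P : Measure (FullData p))] σ ∘ covariates) (y : ℝ) :
    K.missPoint P y ≤ K.supMissEffect c := by
  have hw := measurable_withEffect (p := p) y
  set Q : ProbabilityMeasure (FullData p) := P.map hw.aemeasurable
  have hQ : Q ∈ classSI p c := by
    refine mem_classSI_of_treatment_ae_eq (map_withEffect_mem_classE hP y) hσ ?_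
    exact (ae_map_iff hw.aemeasurable (measurableSet_eq_fun measurable_treatment
      (hσ.comp measurable_covariates))).2 h
  have heffect : ∀ᵐ o ∂(Q : Measure (FullData p)), effect o = y :=
    (ae_map_iff hw.aemeasurable (measurableSet_eq_fun measurable_effect measurable_const)).2
      (ae_of_all _ (effect_withEffect y))
  calc K.missPoint P y = K.missPoint Q y := (K.missPoint_map_withEffect P y).symm
    _ = K.missEffect Q := K.missPoint_eq_missEffect heffect
    _ ≤ K.supMissEffect c := le_iSup₂ (f := fun P (_ : P ∈ classSI p c) => K.missEffect P) Q hQ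

theorem missPoint_map_withTreatment_le_supMissEffect (hP : P ∈ classE p c)
    {σ : (Fin p → ℝ) → Bool} (hσ : Measurable σ) (y : ℝ) :
    K.missPoint (P.map (measurable_withTreatment_comp_covariates hσ).aemeasurable) y ≤
      K.supMissEffect c :=
  K.missPoint_le_supMissEffect_of_treatment_ae_eq (map_withTreatment_mem_classE hP hσ) hσ
    ((ae_map_iff (measurable_withTreatment_comp_covariates hσ).aemeasurable (measurableSet_eq_fun
      measurable_treatment (hσ.comp measurable_covariates))).2 (ae_of_all _ fun _ => rfl)) y

theorem missPoint_le_supMissEffect_add (hP : P ∈ classE p c) {V κ : Type*} [MeasurableSpace V]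
    {θ : Measure V} [IsProbabilityMeasure θ] {τ : (Fin p → ℝ) → V → Bool}
    (hτ : Measurable (uncurry τ))
    (hmap : ((P : Measure (FullData p)).prod θ).map
      (fun q => withTreatment q.1 (τ (covariates q.1) q.2)) = P)
    [MeasurableSpace κ] [Countable κ] [MeasurableSingletonClass κ] {b : (Fin p → ℝ) → κ}
    (hb : Measurable b) (y : ℝ) :
    K.missPoint P y ≤ K.supMissEffect c +
      (Measure.pi fun _ : Fin n => (P : Measure (FullData p)))
        {w | ¬ Injective fun i => b (covariates (w i))} := by
  set ν := (P : Measure (FullData p)).map covariates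
  have := Measure.isProbabilityMeasure_map (μ := (P : Measure (FullData p)))
    measurable_covariates.aemeasurable
  have hG : Measurable fun q : FullData p × V => withTreatment q.1 (τ (covariates q.1) q.2) :=
    measurable_withTreatment.comp (measurable_fst.prodMk
      (hτ.comp ((measurable_covariates.comp measurable_fst).prodMk measurable_snd)))
  have hF : Measurable fun z : Fin n → FullData p × V => K.missPointGiven ν y
      fun i => observe (withTreatment (z i).1 (τ (covariates (z i).1) (z i).2)) :=
    (K.measurable_missPointGiven ν y).comp <| measurable_pi_lambda _ fun i =>
      measurable_observe.comp (hG.comp (measurable_pi_apply i))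
  have hshared : ∀ U : κ → V, ∫⁻ w, K.missPointGiven ν y (fun i =>
      observe (withTreatment (w i) (τ (covariates (w i)) (U (b (covariates (w i)))))))
        ∂(Measure.pi fun _ : Fin n => (P : Measure (FullData p))) ≤ K.supMissEffect c := fun U => by
    have hσ : Measurable fun x => τ x (U (b x)) :=
      hτ.comp (measurable_id.prodMk ((Measurable.of_discrete (f := U)).comp hb))
    exact (K.missPoint_map_eq_lintegral P (measurable_withTreatment_comp_covariates hσ)
      (fun _ => rfl) y).symm.trans_le (K.missPoint_map_withTreatment_le_supMissEffect hP hσ y)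
  rw [K.missPoint_eq_lintegral_of_map_eq hG hmap]
  refine (lintegral_pi_prod_le_lintegral_infinitePi_add _ θ (hb.comp measurable_covariates) hF
    fun _ => missPointGiven_le_one).trans (add_le_add_left ?_ _)
  refine (lintegral_mono hshared).trans_eq ?_
  rw [lintegral_const, measure_univ, mul_one]

theorem missPoint_le_supMissEffect (hP : P ∈ classSI p c) (y : ℝ) :
    K.missPoint P y ≤ K.supMissEffect c := by
  obtain ⟨τ, hτ, hmap⟩ := exists_map_withTreatment_eq hP
  obtain ⟨j, hj⟩ := hP.1.1
  have : NullSingletonClass ((P : Measure (FullData p)).map fun o => covariates o j) :=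
    ⟨fun x => hj (measure_singleton x)⟩
  have hlim := (tendsto_pi_not_injective_floor_mul (ι := Fin n) (P : Measure (FullData p))
    (f := fun o => covariates o j) (by fun_prop)).const_add (K.supMissEffect c)
  rw [add_zero] at hlim
  exact ge_of_tendsto' hlim fun M => K.missPoint_le_supMissEffect_add hP.1 hτ hmap
    (b := fun x => ⌊(M : ℝ) * x j⌋) (by fun_prop) y

end Coverage

section ExpectedLength

variable (P : ProbabilityMeasure (FullData p))

instance : IsProbabilityMeasure (K.law P) := by
  unfold law
  infer_instance

theorem measurableSet_mem_predicted :
    MeasurableSet {q : Experiment p n S × ℝ | q.2 ∈ K.predicted q.1} := by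
  have h : Measurable fun q : Experiment p n S × ℝ =>
      (q.1.1, (fun i => observe (q.1.2.1 i)), covariates q.1.2.2, q.2) := by fun_prop
  exact h K.measurableSet_mem

theorem expectedLength_eq_lintegral : K.expectedLength P = ∫⁻ y, (1 - K.missPoint P y) := by
  have h := K.measurableSet_mem_predicted
  calc K.expectedLength P
      = ((K.law P).prod volume) {q : Experiment p n S × ℝ | q.2 ∈ K.predicted q.1} :=
        (Measure.prod_apply h).symm
    _ = ∫⁻ y, K.law P {ω | y ∈ K.predicted ω} := Measure.prod_apply_symm h
    _ = ∫⁻ y, (1 - K.missPoint P y) := lintegral_congr fun y => by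
        have hy : MeasurableSet {ω | y ∈ K.predicted ω} := measurable_prodMk_right h
        exact compl_compl {ω | y ∈ K.predicted ω} ▸ prob_compl_eq_one_sub hy.compl

variable {P}

theorem expectedLength_eq_top_of_missPoint_le {a : ENNReal} (ha : a < 1)
    (h : ∀ y, K.missPoint P y ≤ a) : K.expectedLength P = ⊤ := by
  rw [K.expectedLength_eq_lintegral, eq_top_iff]
  calc (⊤ : ENNReal) = ∫⁻ _ : ℝ, (1 - a) := by
        rw [lintegral_const, Real.volume_univ, ENNReal.mul_top (tsub_pos_of_lt ha).ne']
    _ ≤ ∫⁻ y, (1 - K.missPoint P y) := lintegral_mono fun y => tsub_le_tsub_left (h y) 1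

end ExpectedLength

end PredictionSet

end ITE

theorem mainTheorem7 {p n : ℕ} {S : Type*} [MeasurableSpace S] (c : ITE.ContinuityNotion)
    (K : ITE.PredictionSet p n S) (α : ℝ) (hα : α ∈ Set.Ioo (0 : ℝ) 1)
    (hcov : K.supMissEffect c ≤ ENNReal.ofReal α) :
    ∀ P ∈ ITE.classSI p c,
      (∀ y : ℝ, K.missPoint P y ≤ ENNReal.ofReal α) ∧ K.expectedLength P = ⊤ := by
  intro P hP
  have hmiss : ∀ y : ℝ, K.missPoint P y ≤ ENNReal.ofReal α := fun y =>
    (K.missPoint_le_supMissEffect hP y).trans hcov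
  exact ⟨hmiss, K.expectedLength_eq_top_of_missPoint_le (ENNReal.ofReal_lt_one.2 hα.2) hmiss⟩
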